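/- Let $d_{\mathrm{in}}, d_{\mathrm{out}}, m$ be natural numbers, let $|\psi\rangle=\sum_x \mu_x|x\rangle\in\mathbb{C}^{d_{\mathrm{in}}}$ be a unit vector, let $p_1,\dots,p_m\ge 0$ with $\sum_j p_j=1$, and let $|\phi_j\rangle=\sum_y \nu^j_y|y\rangle\in\mathbb{C}^{d_{\mathrm{out}}}$ ($1\le j\le m$) be unit vectors. Write $\psi=|\psi\rangle\langle\psi|$ and $\phi_j=|\phi_j\rangle\langle\phi_j|$. The standard bases $\{|x\rangle\}$ of $\mathbb{C}^{d_{\mathrm{in}}}$ and $\{|j\rangle\otimes|y\rangle\}$ of $\mathbb{C}^m\otimes\mathbb{C}^{d_{\mathrm{out}}}$ are the incoherent bases, and $\Delta(\cdot)=\sum_i |i\rangle\langle i|\cdot|i\rangle\langle i|$ denotes the completely dephasing channel in the respective incoherent basis. A dephasing-covariant incoherent operation (DIO) is a completely positive trace-preserving linear map $\mathcal{E}$ with $\Delta\circ\mathcal{E}=\mathcal{E}\circ\Delta$. For a real vector $v$, let $v^{\downarrow}$ be the vector of its components in non-increasing order. For vectors $u,v$ with nonnegative entries, write $u\prec v$ if,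 after the shorter vector is extended by zeros to the length of the longer one, $\sum_{i\le k}u^{\downarrow}_i\le\sum_{i\le k}v^{\downarrow}_i$ for every $k$, and $\sum_i u_i=\sum_i v_i$. Let $q=(|\mu_x|^2)_x$ and $q_j=(|\nu^j_y|^2)_y$, i.e. the diagonals of $\Delta(\psi)$ and $\Delta(\phi_j)$. Then there exists a DIO $\mathcal{E}$ from operators on $\mathbb{C}^{d_{\mathrm{in}}}$ to operators on $\mathbb{C}^m\otimes\mathbb{C}^{d_{\mathrm{out}}}$ such that $$\mathcal{E}(\psi)=\sum_{j=1}^m p_j\,|j\rangle\langle j|\otimes\phi_j$$ if and only if $$q\prec\sum_{j=1}^m p_j\,q_j^{\downarrow}.$$ -/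

import Mathlib

open scoped Matrix ComplexOrder MatrixOrder Matrix.Norms.L2Operator CStarAlgebra Kronecker

noncomputable section

/-- The rank-one projector `|ψ⟩⟨ψ|` of a vector, as a matrix in the incoherent basis. -/
def pureState {d : ℕ} (ψ : EuclideanSpace ℂ (Fin d)) : Matrix (Fin d) (Fin d) ℂ :=
  Matrix.vecMulVec ψ.ofLp (star ψ.ofLp)

/-- The completely dephasing channel `Δ(M) = ∑ i, |i⟩⟨i| M |i⟩⟨i|` in the standard basis. For a
product index type this is dephasing in the product basis. -/
def dephase {ι : Type*} [DecidableEq ι] (M : Matrix ι ι ℂ) : Matrix ι ι ℂ :=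
  Matrix.diagonal M.diag

/-- A dephasing-covariant incoherent operation: a quantum channel (completely positive and
trace-preserving linear map) that commutes with dephasing. -/
structure IsDIO {ι κ : Type*} [Fintype ι] [DecidableEq ι] [Fintype κ] [DecidableEq κ]
    (E : Matrix ι ι ℂ →CP Matrix κ κ ℂ) : Prop where
  trace_preserving : ∀ M, (E M).trace = M.trace
  dephasing_covariant : ∀ M, dephase (E M) = E (dephase M)

/-- The incoherent distribution `Δ(ψ)`: the diagonal `(|ψ₁|², …, |ψ_d|²)` of the dephased state. -/
def cohDist {d : ℕ} (ψ : EuclideanSpace ℂ (Fin d)) : Fin d → ℝ :=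
  fun x => ‖ψ x‖ ^ 2

/-- The heralded ensemble state `∑ j, p j |j⟩⟨j| ⊗ |φ j⟩⟨φ j|`. -/
def heraldedState {m d : ℕ} (p : Fin m → ℝ) (φ : Fin m → EuclideanSpace ℂ (Fin d)) :
    Matrix (Fin m × Fin d) (Fin m × Fin d) ℂ :=
  ∑ j, (p j : ℂ) • (Matrix.single j j (1 : ℂ) ⊗ₖ pureState (φ j))

/-- `v↓`: the components of `v` in non-increasing order. -/
def decreasing {n : ℕ} (v : Fin n → ℝ) : Fin n → ℝ :=
  v ∘ Tuple.sort (fun i => -v i)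

theorem decreasing_antitone {n : ℕ} (v : Fin n → ℝ) : Antitone (decreasing v) := fun _ _ h =>
  neg_le_neg_iff.mp (Tuple.monotone_sort (fun i => -v i) h)

/-- Extend a vector to length `N` by trailing zeros (used for `n ≤ N`). -/
def padZeros {n : ℕ} (N : ℕ) (v : Fin n → ℝ) : Fin N → ℝ :=
  fun i => if h : i.val < n then v ⟨i.val, h⟩ else 0

/-- Majorization `u ≺ v`; the shorter vector is first extended by zeros to the length of
the longer one. -/
def Majorized {m n : ℕ} (u : Fin m → ℝ) (v : Fin n → ℝ) : Prop :=
  (∀ k ≤ max m n,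
    ∑ i : Fin (max m n) with i.val < k, decreasing (padZeros (max m n) u) i ≤
      ∑ i : Fin (max m n) with i.val < k, decreasing (padZeros (max m n) v) i) ∧
  ∑ i, u i = ∑ i, v i

end

/-! Necessity. The Choi matrix of a DIO is a Gram matrix of vectors `u x a`, and covariance makes
them orthogonal both in `x` for fixed `a` and in `a` for fixed `x`. Weighted by the amplitudes of
`ψ` they become `z x a`, whose sums over `x` have the target state as Gram matrix. In block `j` that
matrix has rank one, which forces `∑ y, ‖z x (j, y)‖² / |φ j y|² ≤ p j`
(`sum_norm_sq_div_le_of_gram`). Hence selecting inputs of total weight at most `k` selects weight at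
most `k` among the entries of each `q_j`, and no such selection beats the `k` largest
(`sum_mul_le_sum_decreasing`).

Sufficiency. Majorization writes the padded `q` as a mixture, with weights `t e`, of permutations of
the padded right-hand side (`exists_perm_mixture`). Each pair `(e, j)` yields a monomial Kraus
operator taking `ψ` to `√(t e * p j) |j⟩ ⊗ φ j`; the mixture identity is exactly trace preservation
on the support of `ψ`. -/

/-! ### Sorted sums and majorization -/

/-- A fractional selection of total weight at most `k` collects no more than the `k` largest
entries. -/
theorem sum_mul_le_sum_decreasing {n : ℕ} (v a : Fin n → ℝ) (hv : ∀ i, 0 ≤ v i)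
    (ha0 : ∀ i, 0 ≤ a i) (ha1 : ∀ i, a i ≤ 1) (k : ℕ) (hk : ∑ i, a i ≤ k) :
    ∑ i, a i * v i ≤ ∑ i : Fin n with i.val < k, decreasing v i := by
  set e := Tuple.sort (fun i => -v i) with he
  have hsum : ∑ i, a i * v i = ∑ i, a (e i) * decreasing v i :=
    (Equiv.sum_comp e (fun i => a i * v i)).symm
  rw [hsum, Finset.sum_filter]
  rcases le_or_gt n k with hnk | hkn
  · refine Finset.sum_le_sum fun i _ => ?_
    rw [if_pos (i.2.trans_le hnk)]
    exact mul_le_of_le_one_left (hv _) (ha1 _)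
  -- `τ` is the `(k+1)`-st largest entry: moving weight into the first `k` places gains at least `τ`
  -- per unit.
  · set τ := decreasing v ⟨k, hkn⟩
    have hτ : 0 ≤ τ := hv _
    have hcard : ∑ i : Fin n, (if i.val < k then (1 : ℝ) else 0) = k := by
      rw [Finset.sum_boole, Fin.card_filter_val_lt, min_eq_right hkn.le]
    have key : ∀ i : Fin n, a (e i) * decreasing v i - (if i.val < k then decreasing v i else 0) ≤
        (a (e i) - if i.val < k then (1 : ℝ) else 0) * τ := by
      intro i
      split_ifs with h
      · have : τ ≤ decreasing v i := decreasing_antitone v (Fin.mk_le_mk.2 h.le : i ≤ ⟨k, hkn⟩)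
        nlinarith [ha1 (e i)]
      · have : decreasing v i ≤ τ :=
          decreasing_antitone v (Fin.mk_le_mk.2 (not_lt.1 h) : (⟨k, hkn⟩ : Fin n) ≤ i)
        nlinarith [ha0 (e i)]
    have := Finset.sum_le_sum fun i (_ : i ∈ Finset.univ) => key i
    rw [Finset.sum_sub_distrib, ← Finset.sum_mul, Finset.sum_sub_distrib, hcard,
      Equiv.sum_comp e a] at this
    nlinarith

theorem sum_decreasing {n : ℕ} (v : Fin n → ℝ) : ∑ i, decreasing v i = ∑ i, v i :=
  Equiv.sum_comp (Tuple.sort fun i => -v i) v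

theorem sum_mul_le_sum_decreasing_mul {n : ℕ} (c v : Fin n → ℝ) :
    ∑ i, c i * v i ≤ ∑ i, decreasing c i * decreasing v i := by
  have hm : Monovary (decreasing c) (decreasing v) :=
    (decreasing_antitone c).monovary (decreasing_antitone v)
  set e := Tuple.sort (fun i => -c i)
  set f := Tuple.sort (fun i => -v i)
  calc ∑ i, c i * v i = ∑ i, c (e i) * v (e i) := (Equiv.sum_comp e fun i => c i * v i).symm
    _ = ∑ i, decreasing c i * decreasing v ((e.trans f.symm) i) := by
        simp [decreasing, e, f]
    _ ≤ _ := hm.sum_mul_comp_perm_le_sum_mul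

/-- Abel summation: nonnegative partial sums of `d` are paired with the nonnegative drops of `c`. -/
theorem sum_antitone_mul_nonneg {n : ℕ} (c d : Fin n → ℝ) (hc : Antitone c)
    (hd : ∀ k ≤ n, 0 ≤ ∑ i : Fin n with i.val < k, d i) (hd0 : ∑ i, d i = 0) :
    0 ≤ ∑ i, c i * d i := by
  rcases n with _ | n
  · simp
  -- Clamping the index keeps the extension to `ℕ` antitone.
  set c' : ℕ → ℝ := fun i => c ⟨min i n, by omega⟩ with hc'
  set d' : ℕ → ℝ := fun i => if h : i < n + 1 then d ⟨i, h⟩ else 0 with hd'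
  have hanti : ∀ i, c' (i + 1) ≤ c' i := fun i => hc (Fin.mk_le_mk.2 (by omega))
  have hsum : ∀ k ≤ n + 1, ∑ i ∈ Finset.range k, d' i = ∑ i : Fin (n + 1) with i.val < k, d i := by
    intro k hk
    rw [Finset.sum_filter]
    have : ∀ i : Fin (n + 1), (if i.val < k then d i else 0) =
        (fun j : ℕ => if j < k then d' j else 0) i.val := by
      intro i
      have := Nat.lt_succ_iff.1 i.2
      simp [hd', this]
    rw [Finset.sum_congr rfl fun i _ => this i,
      Fin.sum_univ_eq_sum_range (fun j : ℕ => if j < k then d' j else 0), ← Finset.sum_filter]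
    congr 1
    ext i
    simp only [Finset.mem_range, Finset.mem_filter]
    omega
  have h1 : ∑ i, c i * d i = ∑ i ∈ Finset.range (n + 1), c' i • d' i := by
    rw [← Fin.sum_univ_eq_sum_range (fun j : ℕ => c' j • d' j)]
    refine Finset.sum_congr rfl fun i _ => ?_
    have h := Nat.lt_succ_iff.1 i.2
    have : min i.val n = i.val := by omega
    simp [hc', hd', h]
  rw [h1, Finset.sum_range_by_parts, hsum _ le_rfl]
  have h2 : ∑ i : Fin (n + 1) with i.val < n + 1, d i = 0 := by
    rw [← hd0]; congr 1; ext i; simpa using Nat.lt_succ_iff.1 i.2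
  rw [h2, smul_zero, zero_sub, Left.nonneg_neg_iff]
  refine Finset.sum_nonpos fun i hi => ?_
  have hi' : i < n := by simpa using hi
  rw [hsum _ (by omega)]
  exact mul_nonpos_of_nonpos_of_nonneg (sub_nonpos.2 (hanti i)) (hd _ (by omega))

/-- A majorized vector is a mixture of permutations of the majorizing one. -/
theorem exists_perm_mixture {n : ℕ} (u v : Fin n → ℝ)
    (h : ∀ k ≤ n, ∑ i : Fin n with i.val < k, decreasing u i ≤
      ∑ i : Fin n with i.val < k, decreasing v i) (hs : ∑ i, u i = ∑ i, v i) :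
    ∃ t : Equiv.Perm (Fin n) → ℝ, (∀ e, 0 ≤ t e) ∧ ∑ e, t e = 1 ∧
      ∀ i, u i = ∑ e, t e * v (e i) := by
  let L : (Equiv.Perm (Fin n) → ℝ) →ₗ[ℝ] (Fin n → ℝ) :=
    ∑ e : Equiv.Perm (Fin n), (LinearMap.proj e).smulRight (fun i => v (e i))
  have hL : ∀ t i, L t i = ∑ e, t e * v (e i) := fun t i => by simp [L]
  suffices hu : u ∈ L '' stdSimplex ℝ (Equiv.Perm (Fin n)) by
    obtain ⟨t, ht, rfl⟩ := hu
    exact ⟨t, ht.1, ht.2, hL t⟩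
  by_contra hu
  -- Otherwise a functional strictly separates `u` from the hull of the permutations of `v`.
  -- Rearrangement and Abel summation bound its value at `u` by the sorted pairing, which some
  -- permutation of `v` attains.
  obtain ⟨f, b, hf, hb⟩ := geometric_hahn_banach_closed_point
    ((convex_stdSimplex ℝ (Equiv.Perm (Fin n))).linear_image L)
    ((isCompact_stdSimplex ℝ (Equiv.Perm (Fin n))).image L.continuous_of_finiteDimensional).isClosed
    hu
  set c : Fin n → ℝ := fun i => f (Pi.single i 1) with hc
  have hfc : ∀ w : Fin n → ℝ, f w = ∑ i, c i * w i := by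
    intro w
    conv_lhs => rw [← Finset.univ_sum_single w, map_sum]
    refine Finset.sum_congr rfl fun i _ => ?_
    have : (Pi.single i (w i) : Fin n → ℝ) = w i • Pi.single i 1 := by
      rw [← Pi.single_smul, smul_eq_mul, mul_one]
    rw [this, map_smul, smul_eq_mul, mul_comm]
  set e := Tuple.sort (fun i => -c i)
  set g := Tuple.sort (fun i => -v i)
  have h1 : f u ≤ ∑ i, decreasing c i * decreasing v i := by
    rw [hfc]
    refine (sum_mul_le_sum_decreasing_mul c u).trans ?_
    have := sum_antitone_mul_nonneg (decreasing c) (fun i => decreasing v i - decreasing u i)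
      (decreasing_antitone c)
      (fun k hk => by rw [Finset.sum_sub_distrib]; exact sub_nonneg.2 (h k hk))
      (by rw [Finset.sum_sub_distrib, sum_decreasing, sum_decreasing, hs, sub_self])
    simp only [mul_sub, Finset.sum_sub_distrib] at this
    linarith
  have h2 : f (L (Pi.single (e.symm.trans g) 1)) = ∑ i, decreasing c i * decreasing v i := by
    rw [hfc, ← Equiv.sum_comp e]
    refine Finset.sum_congr rfl fun i _ => ?_
    rw [hL, Finset.sum_eq_single (e.symm.trans g)]
    · simp [decreasing, e, g]
    · intro e' _ he'; simp [Pi.single_eq_of_ne he']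
    · simp
  have h3 := hf _ ⟨_, single_mem_stdSimplex ℝ (e.symm.trans g), rfl⟩
  linarith

/-! ### Complete positivity, Kraus maps and Choi matrices -/

/-- Flattening the blocks preserves products and adjoints, hence elements of the form `star X * X`.
-/
theorem cstarMatrix_nonneg_iff_posSemidef {k n : Type*} [Fintype k] [Fintype n]
    [DecidableEq n] (M : CStarMatrix k k (Matrix n n ℂ)) :
    0 ≤ M ↔ (Matrix.of fun a b : k × n => M a.1 b.1 a.2 b.2).PosSemidef := by
  classical
  constructor
  · intro h
    rw [StarOrderedRing.nonneg_iff] at h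
    induction h using AddSubmonoid.closure_induction with
    | mem x hx =>
      obtain ⟨X, rfl⟩ := hx
      convert Matrix.posSemidef_conjTranspose_mul_self
        (Matrix.of fun a b : k × n => X a.1 b.1 a.2 b.2) using 1
      ext a b
      simp only [Matrix.of_apply, Matrix.mul_apply, Matrix.conjTranspose_apply,
        CStarMatrix.mul_apply, Matrix.sum_apply, Fintype.sum_prod_type]
      rfl
    | zero => exact Matrix.PosSemidef.zero
    | add x y _ _ hx hy => exact hx.add hy
  · intro h
    obtain ⟨B, hB⟩ := CStarAlgebra.nonneg_iff_eq_star_mul_self.1 h.nonneg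
    let X : CStarMatrix k k (Matrix n n ℂ) :=
      CStarMatrix.ofMatrix fun i j => Matrix.of fun a b => B (i, a) (j, b)
    have : M = star X * X := by
      ext i j a b
      have := congrFun (congrFun hB (i, a)) (j, b)
      simp only [Matrix.of_apply, Matrix.mul_apply, Fintype.sum_prod_type] at this
      simp only [CStarMatrix.mul_apply, Matrix.sum_apply, Matrix.mul_apply]
      exact this
    rw [this]
    exact star_mul_self_nonneg X

/-- The completely positive map with given Kraus operators. -/
noncomputable def krausMap {ι n κ : Type*} [Fintype ι] [Fintype n] [DecidableEq n] [Fintype κ]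
    [DecidableEq κ] (K : ι → Matrix κ n ℂ) : Matrix n n ℂ →CP Matrix κ κ ℂ where
  toFun M := ∑ i, K i * M * (K i)ᴴ
  map_add' M N := by simp [Matrix.mul_add, Matrix.add_mul, Finset.sum_add_distrib]
  map_smul' c M := by simp [Finset.smul_sum]
  map_cstarMatrix_nonneg' k M hM := by
    rw [cstarMatrix_nonneg_iff_posSemidef] at hM ⊢
    have : (Matrix.of fun a b : Fin k × κ => ∑ i, (K i * M a.1 b.1 * (K i)ᴴ) a.2 b.2) =
        ∑ i, ((1 : Matrix (Fin k) (Fin k) ℂ) ⊗ₖ K i) *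
          (Matrix.of fun a b : Fin k × n => M a.1 b.1 a.2 b.2) *
          ((1 : Matrix (Fin k) (Fin k) ℂ) ⊗ₖ K i)ᴴ := by
      ext a b
      simp only [Matrix.of_apply, Matrix.sum_apply]
      refine Finset.sum_congr rfl fun i _ => ?_
      simp only [Matrix.mul_apply, Fintype.sum_prod_type, Matrix.one_apply, Finset.sum_mul,
        Matrix.kroneckerMap_apply, Matrix.conjTranspose_apply, Matrix.of_apply, ite_mul, one_mul,
        zero_mul, apply_ite star, star_zero, mul_ite, mul_zero]
      simp
    convert Matrix.posSemidef_sum Finset.univ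
      fun i _ => hM.mul_mul_conjTranspose_same ((1 : Matrix (Fin k) (Fin k) ℂ) ⊗ₖ K i) using 1
    rw [← this]
    ext a b
    simp only [Matrix.of_apply, ← Matrix.sum_apply]
    rfl

theorem krausMap_apply {ι n κ : Type*} [Fintype ι] [Fintype n] [DecidableEq n] [Fintype κ]
    [DecidableEq κ] (K : ι → Matrix κ n ℂ) (M : Matrix n n ℂ) :
    krausMap K M = ∑ i, K i * M * (K i)ᴴ := rfl

/-- The Choi matrix of a completely positive map is a Gram matrix. -/
theorem exists_gram_of_completelyPositive {n κ : Type*} [Fintype n] [DecidableEq n] [Fintype κ]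
    [DecidableEq κ] (E : Matrix n n ℂ →CP Matrix κ κ ℂ) :
    ∃ u : n → κ → EuclideanSpace ℂ (n × κ), ∀ x x' a b,
      E (Matrix.single x x' 1) a b = inner ℂ (u x a) (u x' b) := by
  -- Flattened, `M` is the unnormalized maximally entangled projector; its blockwise image under `E`
  -- is the Choi matrix.
  let M : CStarMatrix n n (Matrix n n ℂ) := CStarMatrix.ofMatrix fun x x' => Matrix.single x x' 1
  have hM : 0 ≤ M := by
    rw [cstarMatrix_nonneg_iff_posSemidef]
    let w : n × n → ℂ := fun a => if a.1 = a.2 then 1 else 0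
    convert Matrix.posSemidef_vecMulVec_self_star w using 1
    ext a b
    simp only [Matrix.of_apply, Matrix.vecMulVec_apply, Pi.star_apply, w]
    change Matrix.single a.1 b.1 (1 : ℂ) a.2 b.2 = _
    rw [Matrix.single_apply]
    split_ifs <;> simp_all
  have h := (cstarMatrix_nonneg_iff_posSemidef _).1 (E.map_cstarMatrix_nonneg M hM)
  obtain ⟨B, hB⟩ := CStarAlgebra.nonneg_iff_eq_star_mul_self.1 h.nonneg
  refine ⟨fun x a => WithLp.toLp 2 fun i => B i (x, a), fun x x' a b => ?_⟩
  have := congrFun (congrFun hB (x, a)) (x', b)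
  simp only [Matrix.of_apply, Matrix.mul_apply] at this
  simp only [PiLp.inner_apply, RCLike.inner_apply']
  exact this

/-! ### The rank-one Gram bound -/

theorem inner_self_eq_ofReal_norm_sq {H : Type*} [NormedAddCommGroup H] [InnerProductSpace ℂ H]
    (x : H) : inner ℂ x x = ((‖x‖ ^ 2 : ℝ) : ℂ) := by
  rw [inner_self_eq_norm_sq_to_K, Complex.ofReal_pow]; rfl

theorem norm_sq_sum_of_orthogonal {X H : Type*} [Fintype X] [NormedAddCommGroup H]
    [InnerProductSpace ℂ H] (z : X → H) (h : ∀ x x', x ≠ x' → inner ℂ (z x) (z x') = 0) :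
    ‖∑ x, z x‖ ^ 2 = ∑ x, ‖z x‖ ^ 2 := by
  have : inner ℂ (∑ x, z x) (∑ x, z x) = ∑ x, inner ℂ (z x) (z x) := by
    simp_rw [sum_inner, inner_sum]
    refine Finset.sum_congr rfl fun x _ => ?_
    exact Finset.sum_eq_single x (fun x' _ hx => h _ _ hx.symm) (by simp)
  simp only [inner_self_eq_ofReal_norm_sq] at this
  exact_mod_cast this

section GramBound

variable {X Y H : Type*} [Fintype X] [NormedAddCommGroup H] [InnerProductSpace ℂ H]
  {z : X → Y → H} {f : Y → ℂ} {P : ℝ}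

theorem sum_norm_sq_eq_of_gram (hz : ∀ y x x', x ≠ x' → inner ℂ (z x y) (z x' y) = 0)
    (hw : ∀ y y', inner ℂ (∑ x, z x y) (∑ x, z x y') = P * f y * star (f y')) (y : Y) :
    ∑ x, ‖z x y‖ ^ 2 = P * ‖f y‖ ^ 2 := by
  rw [← norm_sq_sum_of_orthogonal _ (hz y)]
  have := hw y y
  rw [inner_self_eq_ofReal_norm_sq, mul_assoc, RCLike.star_def, Complex.mul_conj'] at this
  exact_mod_cast this

/-- If the vectors `∑ x, z x y` have a rank-one Gram matrix, then the weights of the orthogonal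
pieces `z x y`, relative to the diagonal of the normalized Gram matrix, sum to at most `P`. -/
theorem sum_norm_sq_div_le_of_gram [Fintype Y] (hf : ∑ y, ‖f y‖ ^ 2 = 1)
    (hz : ∀ y x x', x ≠ x' → inner ℂ (z x y) (z x' y) = 0)
    (hz' : ∀ x y y', y ≠ y' → inner ℂ (z x y) (z x y') = 0)
    (hw : ∀ y y', inner ℂ (∑ x, z x y) (∑ x, z x y') = P * f y * star (f y')) (x : X) :
    ∑ y, ‖z x y‖ ^ 2 / ‖f y‖ ^ 2 ≤ P := by
  set w : Y → H := fun y => ∑ x, z x y with hwdef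
  -- Rank one means that every `w y` is a multiple of a single vector; `c` is that vector, with
  -- `‖c‖² = P`.
  set c : H := ∑ y, f y • w y with hc
  have hfC : ∑ y, star (f y) * f y = 1 := by
    simp_rw [RCLike.star_def, Complex.conj_mul']
    exact_mod_cast hf
  have hwc : ∀ y, inner ℂ (w y) c = P * f y := by
    intro y
    simp only [hc, inner_sum, inner_smul_right]
    calc ∑ y', f y' * inner ℂ (w y) (w y') = ∑ y', P * f y * (star (f y') * f y') :=
          Finset.sum_congr rfl fun y' _ => by rw [hw]; ring
      _ = P * f y := by rw [← Finset.mul_sum, hfC, mul_one]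
  have hcc : inner ℂ c c = P := by
    conv_lhs => enter [2]; rw [hc]
    simp only [sum_inner, inner_smul_left, hwc]
    calc ∑ y, (starRingEnd ℂ) (f y) * (P * f y) = ∑ y, P * (star (f y) * f y) :=
          Finset.sum_congr rfl fun y _ => by rw [RCLike.star_def]; ring
      _ = P := by rw [← Finset.mul_sum, hfC, mul_one]
  have hw_eq : ∀ y, w y = star (f y) • c := by
    intro y
    rw [← sub_eq_zero, ← inner_self_eq_zero (𝕜 := ℂ)]
    have hcw : inner ℂ c (w y) = P * star (f y) := by
      rw [← inner_conj_symm, hwc]; simp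
    simp only [inner_sub_left, inner_sub_right, inner_smul_left, inner_smul_right, hcc, hwc, hcw,
      show inner ℂ (w y) (w y) = _ from hw y y]
    simp only [RCLike.star_def, RingHomCompTriple.comp_apply, RingHom.id_apply]
    ring
  have hzc : ∀ y, star (f y) * inner ℂ (z x y) c = (‖z x y‖ : ℂ) ^ 2 := by
    intro y
    rw [← inner_smul_right, ← hw_eq, hwdef, inner_sum,
      Finset.sum_eq_single x (fun x' _ hx => hz _ _ _ hx.symm) (by simp)]
    exact inner_self_eq_norm_sq_to_K _
  set S : ℝ := ∑ y, ‖z x y‖ ^ 2 / ‖f y‖ ^ 2 with hS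
  -- Here `⟪d, c⟫ = ‖d‖² = S`, so `0 ≤ ‖d - c‖² = P - S`. Terms with `f y = 0` vanish by the
  -- convention for inverses of zero.
  set d : H := ∑ y, (star (f y))⁻¹ • z x y with hd
  have hdc : inner ℂ d c = S := by
    simp only [hd, sum_inner, inner_smul_left, hS, Complex.ofReal_sum]
    refine Finset.sum_congr rfl fun y _ => ?_
    rcases eq_or_ne (f y) 0 with h0 | h0
    · simp [h0]
    · have h1 : star (f y) ≠ 0 := star_ne_zero.2 h0
      have h2 : (starRingEnd ℂ) (star (f y))⁻¹ = (f y)⁻¹ := by simp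
      have h3 : ((‖f y‖ : ℂ)) ^ 2 = star (f y) * f y := (RCLike.conj_mul (f y)).symm
      push_cast
      rw [h2, h3, ← hzc]
      field_simp
  have hdd : ‖d‖ ^ 2 = S := by
    rw [hd, norm_sq_sum_of_orthogonal]
    · refine Finset.sum_congr rfl fun y _ => ?_
      rw [norm_smul, norm_inv, norm_star, mul_pow, inv_pow, div_eq_inv_mul]
    · intro y y' h
      rw [inner_smul_left, inner_smul_right, hz' _ _ _ h, mul_zero, mul_zero]
  have hcc' : ‖c‖ ^ 2 = P := by
    rw [inner_self_eq_ofReal_norm_sq] at hcc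
    exact_mod_cast hcc
  have := norm_sub_sq (𝕜 := ℂ) d c
  rw [hdc, hdd, hcc'] at this
  have h0 := sq_nonneg ‖d - c‖
  have h1 : RCLike.re (S : ℂ) = S := Complex.ofReal_re S
  rw [h1] at this
  linarith

end GramBound

/-! ### Necessity of majorization -/

section Necessity

variable {X : Type*} [Fintype X] {m d : ℕ}

theorem heraldedState_apply (p : Fin m → ℝ) (φ : Fin m → EuclideanSpace ℂ (Fin d))
    (a b : Fin m × Fin d) : heraldedState p φ a b =
      if a.1 = b.1 then (p a.1 : ℂ) * (φ a.1 a.2 * star (φ a.1 b.2)) else 0 := by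
  simp only [heraldedState, pureState, Matrix.sum_apply, Matrix.smul_apply,
    Matrix.kroneckerMap_apply, Matrix.single_apply, Matrix.vecMulVec_apply, smul_eq_mul,
    Pi.star_apply]
  rw [Finset.sum_eq_single a.1]
  · by_cases h : a.1 = b.1 <;> simp [h]
  · intro j _ hj; simp [hj]
  · simp

/-- A Gram decomposition as produced by a DIO bounds the partial sums of the input
distribution. -/
theorem sum_mul_le_sum_of_gram {H : Type*} [NormedAddCommGroup H] [InnerProductSpace ℂ H]
    (p : Fin m → ℝ) (φ : Fin m → EuclideanSpace ℂ (Fin d)) (hp : ∀ j, 0 ≤ p j)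
    (hφ : ∀ j, ‖φ j‖ = 1) (z : X → Fin m × Fin d → H) (q b : X → ℝ)
    (hz : ∀ a x x', x ≠ x' → inner ℂ (z x a) (z x' a) = 0)
    (hz' : ∀ x a a', a ≠ a' → inner ℂ (z x a) (z x a') = 0)
    (hw : ∀ a a', inner ℂ (∑ x, z x a) (∑ x, z x a') = heraldedState p φ a a')
    (hq : ∀ x, q x = ∑ a, ‖z x a‖ ^ 2)
    (hb0 : ∀ x, 0 ≤ b x) (hb1 : ∀ x, b x ≤ 1) (k : ℕ) (hk : ∑ x, b x ≤ k) :
    ∑ x, b x * q x ≤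
      ∑ i : Fin d with i.val < k, (∑ j, p j • decreasing (cohDist (φ j))) i := by
  have hwj : ∀ j y y', inner ℂ (∑ x, z x (j, y)) (∑ x, z x (j, y')) =
      p j * φ j y * star (φ j y') := by
    intro j y y'; rw [hw, heraldedState_apply]; simp [mul_assoc]
  have hf : ∀ j, ∑ y, ‖φ j y‖ ^ 2 = 1 := by
    intro j; rw [← EuclideanSpace.norm_sq_eq, hφ, one_pow]
  have hrow : ∀ j y, ∑ x, ‖z x (j, y)‖ ^ 2 = p j * ‖φ j y‖ ^ 2 := fun j y =>
    sum_norm_sq_eq_of_gram (z := fun x y => z x (j, y)) (fun y x x' h => hz _ _ _ h) (hwj j) y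
  have hcol : ∀ j x, ∑ y, ‖z x (j, y)‖ ^ 2 / ‖φ j y‖ ^ 2 ≤ p j := fun j x =>
    sum_norm_sq_div_le_of_gram (z := fun x y => z x (j, y)) (hf j) (fun y x x' h => hz _ _ _ h)
      (fun x y y' h => hz' _ _ _ (by simpa using h)) (hwj j) x
  have hj : ∀ j, ∑ y, ∑ x, b x * ‖z x (j, y)‖ ^ 2 ≤
      p j * ∑ i : Fin d with i.val < k, decreasing (cohDist (φ j)) i := by
    intro j
    have hle : ∀ y, ∑ x, b x * ‖z x (j, y)‖ ^ 2 ≤ p j * ‖φ j y‖ ^ 2 := by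
      intro y
      rw [← hrow]
      exact Finset.sum_le_sum fun x _ => mul_le_of_le_one_left (sq_nonneg _) (hb1 x)
    have hnn : ∀ y, 0 ≤ ∑ x, b x * ‖z x (j, y)‖ ^ 2 := fun y =>
      Finset.sum_nonneg fun x _ => mul_nonneg (hb0 x) (sq_nonneg _)
    rcases (hp j).eq_or_lt with h0 | hpos
    · rw [← h0, zero_mul]
      refine Finset.sum_nonpos fun y _ => (hle y).trans (by rw [← h0, zero_mul])
    -- The fraction of the weight at `(j, y)` that comes from the selected inputs; row sums give `a
    -- y ≤ 1`, and `hcol` bounds the total by `∑ x, b x`.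
    · set a : Fin d → ℝ := fun y => (∑ x, b x * ‖z x (j, y)‖ ^ 2) / (p j * ‖φ j y‖ ^ 2) with ha
      have hmul : ∀ y, ∑ x, b x * ‖z x (j, y)‖ ^ 2 = p j * (a y * cohDist (φ j) y) := by
        intro y
        rcases eq_or_ne (φ j y) 0 with h | h
        · have := hle y
          have := hnn y
          simp only [h, norm_zero, cohDist] at *
          nlinarith
        · have : ‖φ j y‖ ≠ 0 := norm_ne_zero_iff.2 h
          simp only [ha, cohDist]
          field_simp
      rw [Finset.sum_congr rfl fun y _ => hmul y, ← Finset.mul_sum]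
      refine mul_le_mul_of_nonneg_left ?_ (hp j)
      refine sum_mul_le_sum_decreasing _ _ (fun i => sq_nonneg _)
        (fun y => div_nonneg (hnn y) (by positivity))
        (fun y => div_le_one_of_le₀ (hle y) (by positivity)) k ?_
      calc ∑ y, a y = ∑ x, b x * ((∑ y, ‖z x (j, y)‖ ^ 2 / ‖φ j y‖ ^ 2) / p j) := by
            simp_rw [ha, Finset.sum_div, Finset.mul_sum]
            rw [Finset.sum_comm]
            refine Finset.sum_congr rfl fun x _ => Finset.sum_congr rfl fun y _ => ?_
            rw [div_div, mul_div_assoc, mul_comm (p j)]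
        _ ≤ ∑ x, b x := Finset.sum_le_sum fun x _ =>
            mul_le_of_le_one_right (hb0 x) (div_le_one_of_le₀ (hcol j x) (hp j))
        _ ≤ k := hk
  calc ∑ x, b x * q x = ∑ j, ∑ y, ∑ x, b x * ‖z x (j, y)‖ ^ 2 := by
        simp_rw [hq, Fintype.sum_prod_type, Finset.mul_sum]
        rw [Finset.sum_comm]
        exact Finset.sum_congr rfl fun j _ => Finset.sum_comm
    _ ≤ ∑ j, p j * ∑ i : Fin d with i.val < k, decreasing (cohDist (φ j)) i :=
        Finset.sum_le_sum fun j _ => hj j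
    _ = _ := by
        simp_rw [Finset.sum_apply, Pi.smul_apply, smul_eq_mul, Finset.mul_sum]
        exact Finset.sum_comm

end Necessity

theorem sum_cohDist {d : ℕ} (ψ : EuclideanSpace ℂ (Fin d)) (hψ : ‖ψ‖ = 1) :
    ∑ x, cohDist ψ x = 1 := by
  simp only [cohDist]
  rw [← EuclideanSpace.norm_sq_eq, hψ, one_pow]

theorem sum_mixture_decreasing {m d : ℕ} (p : Fin m → ℝ) (hp_sum : ∑ j, p j = 1)
    (φ : Fin m → EuclideanSpace ℂ (Fin d)) (hφ : ∀ j, ‖φ j‖ = 1) :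
    ∑ i, (∑ j, p j • decreasing (cohDist (φ j))) i = 1 := by
  simp_rw [Finset.sum_apply, Pi.smul_apply, smul_eq_mul]
  rw [Finset.sum_comm]
  simp_rw [← Finset.mul_sum, sum_decreasing, sum_cohDist _ (hφ _), mul_one, hp_sum]

theorem sum_mul_padZeros {n N : ℕ} (h : n ≤ N) (v : Fin n → ℝ) (b : Fin N → ℝ) :
    ∑ i, b i * padZeros N v i = ∑ x, b (Fin.castLE h x) * v x := by
  symm
  refine Finset.sum_of_injOn (Fin.castLE h) (Fin.castLE_injective h).injOn (by simp) ?_ ?_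
  · intro i _ hi
    have : ¬ i.val < n := fun hn => hi ⟨⟨i, hn⟩, by simp, by ext; simp⟩
    simp [padZeros, this]
  · intro x _
    simp [padZeros]

theorem sum_padZeros {n N : ℕ} (h : n ≤ N) (v : Fin n → ℝ) :
    ∑ i, padZeros N v i = ∑ x, v x := by
  simpa using sum_mul_padZeros h v 1

theorem padZeros_nonneg {n N : ℕ} (v : Fin n → ℝ) (hv : ∀ i, 0 ≤ v i) (i : Fin N) :
    0 ≤ padZeros N v i := by
  unfold padZeros
  split_ifs
  exacts [hv _, le_rfl]

theorem majorized_of_isDIO {d_in d_out m : ℕ}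
    (ψ : EuclideanSpace ℂ (Fin d_in)) (hψ : ‖ψ‖ = 1)
    (p : Fin m → ℝ) (hp : ∀ j, 0 ≤ p j) (hp_sum : ∑ j, p j = 1)
    (φ : Fin m → EuclideanSpace ℂ (Fin d_out)) (hφ : ∀ j, ‖φ j‖ = 1)
    (E : Matrix (Fin d_in) (Fin d_in) ℂ →CP Matrix (Fin m × Fin d_out) (Fin m × Fin d_out) ℂ)
    (hE : IsDIO E) (hEψ : E (pureState ψ) = heraldedState p φ) :
    Majorized (cohDist ψ) (∑ j, p j • decreasing (cohDist (φ j))) := by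
  refine ⟨fun k hk => ?_, by rw [sum_cohDist _ hψ, sum_mixture_decreasing p hp_sum φ hφ]⟩
  obtain ⟨u, hu⟩ := exists_gram_of_completelyPositive E
  -- Off-diagonal matrix units dephase to zero, so their images have zero diagonal; diagonal units
  -- are fixed, so their images are diagonal.
  have horth : ∀ a x x', x ≠ x' → inner ℂ (u x a) (u x' a) = 0 := by
    intro a x x' h
    have := congrFun (congrFun (hE.dephasing_covariant (Matrix.single x x' 1)) a) a
    rw [show dephase (Matrix.single x x' (1 : ℂ)) = 0 by
      rw [dephase, Matrix.diag_single_of_ne _ _ _ h, Matrix.diagonal_zero'], map_zero] at this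
    rw [← hu]
    simpa [dephase] using this
  have horth' : ∀ x a a', a ≠ a' → inner ℂ (u x a) (u x a') = 0 := by
    intro x a a' h
    have := congrFun (congrFun (hE.dephasing_covariant (Matrix.single x x 1)) a) a'
    rw [show dephase (Matrix.single x x (1 : ℂ)) = Matrix.single x x 1 by
      rw [dephase, Matrix.diag_single_same, Matrix.diagonal_single]] at this
    rw [← hu, ← this, dephase, Matrix.diagonal_apply_ne _ h]
  have htr : ∀ x, ∑ a, ‖u x a‖ ^ 2 = 1 := by
    intro x
    have := hE.trace_preserving (Matrix.single x x 1)
    rw [Matrix.trace_single_eq_same, Matrix.trace] at this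
    simp only [Matrix.diag_apply, hu, inner_self_eq_ofReal_norm_sq] at this
    exact_mod_cast this
  set N := max d_in d_out
  set r := ∑ j, p j • decreasing (cohDist (φ j)) with hr
  have hr0 : ∀ i, 0 ≤ r i := by
    intro i
    simp only [hr, Finset.sum_apply, Pi.smul_apply, smul_eq_mul]
    exact Finset.sum_nonneg fun j _ => mul_nonneg (hp j) (sq_nonneg _)
  set e := Tuple.sort (fun i => -padZeros N (cohDist ψ) i) with he
  -- Indicator of `k` largest entries of the padded input distribution.
  set b : Fin N → ℝ := fun i => if (e.symm i).val < k then 1 else 0 with hb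
  have hb0 : ∀ i, 0 ≤ b i := fun i => by simp only [hb]; split_ifs <;> norm_num
  have hb1 : ∀ i, b i ≤ 1 := fun i => by simp only [hb]; split_ifs <;> norm_num
  have hcard : ∑ i : Fin N, (if i.val < k then (1 : ℝ) else 0) = k := by
    rw [Finset.sum_boole, Fin.card_filter_val_lt, min_eq_right hk]
  have hbk : ∑ i, b i = k := by
    rw [← hcard, ← Equiv.sum_comp e]; simp [hb]
  have hin : d_in ≤ N := le_max_left _ _
  have hout : d_out ≤ N := le_max_right _ _
  calc ∑ i : Fin N with i.val < k, decreasing (padZeros N (cohDist ψ)) i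
      = ∑ i, b i * padZeros N (cohDist ψ) i := by
        rw [← Equiv.sum_comp e, Finset.sum_filter]
        simp [hb, decreasing, he]
    _ = ∑ x, b (Fin.castLE hin x) * cohDist ψ x := sum_mul_padZeros hin _ _
    _ ≤ ∑ i : Fin d_out with i.val < k, r i := by
        -- The conjugate compensates for the inner product being conjugate-linear in its first
        -- argument.
        refine sum_mul_le_sum_of_gram p φ hp hφ (fun x a => star (ψ x) • u x a) _ _ ?_ ?_ ?_ ?_
          (fun x => hb0 _) (fun x => hb1 _) k ?_
        · intro a x x' h
          rw [inner_smul_left, inner_smul_right, horth _ _ _ h, mul_zero, mul_zero]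
        · intro x a a' h
          rw [inner_smul_left, inner_smul_right, horth' _ _ _ h, mul_zero, mul_zero]
        · intro a a'
          have hdec : pureState ψ = ∑ x, ∑ x', (ψ x * star (ψ x')) • Matrix.single x x' (1 : ℂ) := by
            conv_lhs => rw [Matrix.matrix_eq_sum_single (pureState ψ)]
            simp [pureState, Matrix.vecMulVec_apply]
          rw [← hEψ, hdec]
          simp only [map_sum, map_smul, Matrix.sum_apply, Matrix.smul_apply, hu, sum_inner,
            inner_sum, inner_smul_left, inner_smul_right, smul_eq_mul, Finset.mul_sum]
          rw [Finset.sum_comm]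
          refine Finset.sum_congr rfl fun x _ => Finset.sum_congr rfl fun x' _ => ?_
          simp; ring
        · intro x
          simp_rw [norm_smul, mul_pow, ← Finset.mul_sum, htr, norm_star, mul_one, cohDist]
        · rw [← hbk]
          have := sum_mul_padZeros hin (fun _ => 1) b
          simp only [mul_one] at this
          rw [← this]
          refine Finset.sum_le_sum fun i _ => mul_le_of_le_one_right (hb0 i) ?_
          unfold padZeros
          split_ifs <;> norm_num
    _ = ∑ i : Fin N, (if i.val < k then 1 else 0) * padZeros N r i := by
        rw [sum_mul_padZeros hout, Finset.sum_filter]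
        simp
    _ ≤ _ := by
        refine sum_mul_le_sum_decreasing _ _ (padZeros_nonneg r hr0) ?_ ?_ k hcard.le
        all_goals intro i; split_ifs <;> norm_num

/-! ### Monomial Kraus operators and sufficiency -/

section StrictlyIncoherent

variable {ι n κ : Type*} [Fintype ι] [Fintype n] [DecidableEq n] [Fintype κ] [DecidableEq κ]

/-- The matrix sending the basis vector `x` to `a x` times the basis vector `f x`. -/
def monomialMatrix {n κ : Type*} [DecidableEq κ] (f : n → κ) (a : n → ℂ) : Matrix κ n ℂ :=
  Matrix.of fun y x => if f x = y then a x else 0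

theorem krausMap_monomialMatrix_apply (f : ι → n → κ) (a : ι → n → ℂ) (M : Matrix n n ℂ)
    (y y' : κ) : krausMap (fun i => monomialMatrix (f i) (a i)) M y y' =
      ∑ i, ∑ x, ∑ x', if f i x = y ∧ f i x' = y' then a i x * M x x' * star (a i x') else 0 := by
  rw [krausMap_apply, Matrix.sum_apply]
  refine Finset.sum_congr rfl fun i _ => ?_
  simp only [Matrix.mul_apply, Matrix.conjTranspose_apply, monomialMatrix, Matrix.of_apply,
    Finset.sum_mul]
  rw [Finset.sum_comm]
  refine Finset.sum_congr rfl fun x _ => Finset.sum_congr rfl fun x' _ => ?_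
  by_cases h : f i x = y <;> by_cases h' : f i x' = y' <;> simp [h, h']

/-- Kraus operators that are injective monomial matrices define a dephasing-covariant operation. -/
theorem isDIO_krausMap_monomialMatrix (f : ι → n → κ) (a : ι → n → ℂ)
    (hinj : ∀ i x x', x ≠ x' → f i x = f i x' → a i x = 0 ∨ a i x' = 0)
    (hnorm : ∀ x, ∑ i, ‖a i x‖ ^ 2 = 1) :
    IsDIO (krausMap fun i => monomialMatrix (f i) (a i)) := by
  have hdiag : ∀ M y y', krausMap (fun i => monomialMatrix (f i) (a i)) (dephase M) y y' =
      ∑ i, ∑ x, if f i x = y ∧ f i x = y' then (‖a i x‖ : ℂ) ^ 2 * M x x else 0 := by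
    intro M y y'
    rw [krausMap_monomialMatrix_apply]
    refine Finset.sum_congr rfl fun i _ => Finset.sum_congr rfl fun x _ => ?_
    rw [Finset.sum_eq_single x]
    · rw [dephase, Matrix.diagonal_apply_eq, Matrix.diag_apply, ← Complex.mul_conj',
        RCLike.star_def, mul_right_comm]
    · intro x' _ hx
      rw [dephase, Matrix.diagonal_apply_ne _ hx.symm]
      simp
    · simp
  have hcov : ∀ M, dephase (krausMap (fun i => monomialMatrix (f i) (a i)) M) =
      krausMap (fun i => monomialMatrix (f i) (a i)) (dephase M) := by
    intro M
    ext y y'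
    rw [hdiag]
    by_cases hy : y = y'
    · subst hy
      rw [dephase, Matrix.diagonal_apply_eq, Matrix.diag_apply, krausMap_monomialMatrix_apply]
      refine Finset.sum_congr rfl fun i _ => Finset.sum_congr rfl fun x _ => ?_
      rw [Finset.sum_eq_single x]
      · rw [← Complex.mul_conj', RCLike.star_def, mul_right_comm]
      · intro x' _ hx
        split_ifs with h
        · rcases hinj i x x' hx.symm (h.1.trans h.2.symm) with h0 | h0 <;> simp [h0]
        · rfl
      · simp
    · rw [dephase, Matrix.diagonal_apply_ne _ hy]
      symm
      refine Finset.sum_eq_zero fun i _ => Finset.sum_eq_zero fun x _ => if_neg fun h => ?_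
      exact hy (h.1.symm.trans h.2)
  refine ⟨fun M => ?_, hcov⟩
  -- The trace sees only the diagonal, so covariance reduces trace preservation to dephased inputs.
  have h1 : ∀ {μ : Type _} [Fintype μ] [DecidableEq μ] (A : Matrix μ μ ℂ),
      A.trace = (dephase A).trace := fun A => by simp [dephase, Matrix.trace]
  rw [h1, hcov]
  simp only [Matrix.trace, Matrix.diag_apply, hdiag, and_self]
  rw [Finset.sum_comm]
  calc _ = ∑ i, ∑ x, (‖a i x‖ : ℂ) ^ 2 * M x x := by
        refine Finset.sum_congr rfl fun i _ => ?_
        rw [Finset.sum_comm]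
        simp
    _ = ∑ x, ((∑ i, ‖a i x‖ ^ 2 : ℝ) : ℂ) * M x x := by
        rw [Finset.sum_comm]
        push_cast
        simp_rw [Finset.sum_mul]
    _ = _ := by simp [hnorm]

end StrictlyIncoherent

theorem krausMap_pureState {ι κ : Type*} [Fintype ι] [Fintype κ] [DecidableEq κ] {d : ℕ}
    (K : ι → Matrix κ (Fin d) ℂ) (ψ : EuclideanSpace ℂ (Fin d)) :
    krausMap K (pureState ψ) =
      ∑ i, Matrix.vecMulVec (K i *ᵥ ψ.ofLp) (star (K i *ᵥ ψ.ofLp)) := by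
  rw [krausMap_apply]
  refine Finset.sum_congr rfl fun i _ => ?_
  rw [pureState, Matrix.mul_vecMulVec, Matrix.vecMulVec_mul, Matrix.star_mulVec]

theorem exists_isDIO_of_majorized {d_in d_out m : ℕ}
    (ψ : EuclideanSpace ℂ (Fin d_in))
    (p : Fin m → ℝ) (hp : ∀ j, 0 ≤ p j) (hp_sum : ∑ j, p j = 1)
    (φ : Fin m → EuclideanSpace ℂ (Fin d_out)) (hφ : ∀ j, ‖φ j‖ = 1)
    (hmaj : Majorized (cohDist ψ) (∑ j, p j • decreasing (cohDist (φ j)))) :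
    ∃ E : Matrix (Fin d_in) (Fin d_in) ℂ →CP
        Matrix (Fin m × Fin d_out) (Fin m × Fin d_out) ℂ,
      IsDIO E ∧ E (pureState ψ) = heraldedState p φ := by
  set N := max d_in d_out
  set r := ∑ j, p j • decreasing (cohDist (φ j)) with hr
  have hin : d_in ≤ N := le_max_left _ _
  have hout : d_out ≤ N := le_max_right _ _
  have hr_apply : ∀ l, r l = ∑ j, p j * decreasing (cohDist (φ j)) l := fun l => by
    simp [hr, Finset.sum_apply]
  have hdec0 : ∀ j l, 0 ≤ decreasing (cohDist (φ j)) l := fun j l => sq_nonneg _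
  have hr0 : ∀ i, 0 ≤ r i := fun i => by
    rw [hr_apply]; exact Finset.sum_nonneg fun j _ => mul_nonneg (hp j) (hdec0 _ _)
  obtain ⟨t, ht0, ht1, ht⟩ := exists_perm_mixture (padZeros N (cohDist ψ)) (padZeros N r)
    hmaj.1 (by rw [sum_padZeros hin, sum_padZeros hout]; exact hmaj.2)
  have hm : Nonempty (Fin m) := by
    by_contra h
    rw [not_nonempty_iff] at h
    simp at hp_sum
  obtain ⟨j₀⟩ := hm
  have hd : Nonempty (Fin d_out) := by
    by_contra h
    rw [not_nonempty_iff] at h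
    have := sum_cohDist _ (hφ j₀)
    simp at this
  obtain ⟨y₀⟩ := hd
  let s : (j : Fin m) → Equiv.Perm (Fin d_out) := fun j => Tuple.sort (fun i => -cohDist (φ j) i)
  have hs : ∀ j l, decreasing (cohDist (φ j)) l = ‖φ j (s j l)‖ ^ 2 := fun j l => rfl
  let f : (Equiv.Perm (Fin N) × Fin m) ⊕ Fin d_in → Fin d_in → Fin m × Fin d_out :=
    Sum.elim
      (fun i x => (i.2, if h : (i.1 (Fin.castLE hin x)).val < d_out then s i.2 ⟨_, h⟩ else y₀))
      (fun _ _ => (j₀, y₀))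
  -- Dividing by `ψ x` makes operator `(e, j)` output a multiple of `φ j`. The `inr` operators
  -- restore normalization on basis vectors outside the support of `ψ` and annihilate `ψ`. The
  -- targets `y₀` and `j₀` are arbitrary: `y₀` in the `inl` family carries amplitude zero, and each
  -- `inr` operator has at most one nonzero column.
  let a : (Equiv.Perm (Fin N) × Fin m) ⊕ Fin d_in → Fin d_in → ℂ :=
    Sum.elim
      (fun i x => if h : (i.1 (Fin.castLE hin x)).val < d_out then
        (√(t i.1 * p i.2) : ℂ) * φ i.2 (s i.2 ⟨_, h⟩) / ψ x else 0)
      (fun x₀ x => if x = x₀ ∧ ψ x = 0 then 1 else 0)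
  -- A zero entry of the mixture has only zero terms. So no amplitude is lost where `ψ` vanishes or
  -- where `e.symm` leads into the padding.
  have hvanish : ∀ (e : Equiv.Perm (Fin N)) (j : Fin m) (l : Fin d_out),
      padZeros N (cohDist ψ) (e.symm (Fin.castLE hout l)) = 0 →
        (√(t e * p j) : ℂ) * φ j (s j l) = 0 := by
    intro e j l h
    rw [ht, Finset.sum_eq_zero_iff_of_nonneg
      fun e _ => mul_nonneg (ht0 e) (padZeros_nonneg r hr0 _)] at h
    have h1 := h e (Finset.mem_univ e)
    have h2 : padZeros N r (Fin.castLE hout l) = r l := by simp [padZeros]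
    rw [Equiv.apply_symm_apply, h2, mul_eq_zero] at h1
    rcases h1 with h1 | h1
    · simp [h1]
    · rw [hr_apply, Finset.sum_eq_zero_iff_of_nonneg
        fun j _ => mul_nonneg (hp j) (hdec0 _ _)] at h1
      have h3 := h1 j (Finset.mem_univ j)
      rw [hs, mul_eq_zero] at h3
      rcases h3 with h3 | h3
      · simp [h3]
      · rw [norm_eq_zero.1 (pow_eq_zero_iff two_ne_zero |>.1 h3), mul_zero]
  have hact : ∀ e j b, (monomialMatrix (f (.inl (e, j))) (a (.inl (e, j))) *ᵥ ψ.ofLp) b =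
      if j = b.1 then (√(t e * p j) : ℂ) * φ j b.2 else 0 := by
    rintro e j ⟨j', y⟩
    simp only [Matrix.mulVec, dotProduct, monomialMatrix, Matrix.of_apply, f, Sum.elim_inl,
      Prod.mk.injEq]
    by_cases hj : j = j'
    · subst hj
      simp only [true_and, if_true]
      set l := (s j).symm y with hl
      have hy : y = s j l := by simp [hl]
      set i := e.symm (Fin.castLE hout l) with hi
      have hei : e i = Fin.castLE hout l := by simp [hi]
      have huniq : ∀ x, (if (if h : (e (Fin.castLE hin x)).val < d_out then s j ⟨_, h⟩ else y₀) = y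
          then a (.inl (e, j)) x else 0) ≠ 0 → Fin.castLE hin x = i := by
        intro x hx
        by_cases h : (e (Fin.castLE hin x)).val < d_out
        · rw [dif_pos h] at hx
          have h1 : s j ⟨_, h⟩ = y := by
            by_contra h1; rw [if_neg h1] at hx; exact hx rfl
          rw [hy, (s j).apply_eq_iff_eq] at h1
          apply e.injective
          rw [hei, ← h1]
          ext; rfl
        · exact absurd (by simp [a, h]) hx
      by_cases hid : i.val < d_in
      · set x₀ : Fin d_in := ⟨i.val, hid⟩
        have hx₀ : Fin.castLE hin x₀ = i := by ext; rfl
        rw [Finset.sum_eq_single x₀]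
        · have hlt : (e (Fin.castLE hin x₀)).val < d_out := by rw [hx₀, hei]; exact l.2
          have hll : (⟨_, hlt⟩ : Fin d_out) = l := by
            ext; change (e (Fin.castLE hin x₀)).val = l.val; rw [hx₀, hei]; rfl
          rw [dif_pos hlt, hll, if_pos hy.symm]
          simp only [a, Sum.elim_inl, dif_pos hlt, hll]
          rw [hy]
          by_cases h0 : ψ x₀ = 0
          · rw [h0, mul_zero, hvanish e j l]
            rw [← hi, ← hx₀]
            simp [padZeros, cohDist, h0]
          · field_simp
        · intro x _ hx
          by_contra h
          exact hx (Fin.castLE_injective hin ((huniq x (left_ne_zero_of_mul h)).trans hx₀.symm))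
        · simp
      · rw [hy, hvanish e j l (by rw [← hi]; simp [padZeros, hid])]
        refine Finset.sum_eq_zero fun x _ => ?_
        by_contra h
        have := huniq x (by rw [hy]; exact left_ne_zero_of_mul h)
        exact hid (by rw [← this]; exact x.2)
    · simp [hj]
  have hact' : ∀ x₀, monomialMatrix (f (.inr x₀)) (a (.inr x₀)) *ᵥ ψ.ofLp = 0 := by
    intro x₀
    ext b
    simp only [Matrix.mulVec, dotProduct, monomialMatrix, Matrix.of_apply, a, Sum.elim_inr,
      Pi.zero_apply]
    refine Finset.sum_eq_zero fun x _ => ?_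
    by_cases h : ψ x = 0 <;> simp [h]
  refine ⟨krausMap fun i => monomialMatrix (f i) (a i),
    isDIO_krausMap_monomialMatrix f a ?_ ?_, ?_⟩
  · rintro (⟨e, j⟩ | x₀) x x' hne hf
    · by_cases h : (e (Fin.castLE hin x)).val < d_out
      · by_cases h' : (e (Fin.castLE hin x')).val < d_out
        · exfalso
          simp only [f, Sum.elim_inl, dif_pos h, dif_pos h', Prod.mk.injEq, true_and,
            (s j).apply_eq_iff_eq, Fin.mk.injEq] at hf
          exact hne (Fin.castLE_injective hin (e.injective (Fin.ext hf)))
        · right; simp [a, h']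
      · left; simp [a, h]
    · by_cases h : x = x₀
      · right; simp [a, h ▸ hne.symm]
      · left; simp [a, h]
  · intro x
    rw [Fintype.sum_sum_type]
    by_cases h0 : ψ x = 0
    -- Division by `ψ x = 0` gives zero, so only the `inr` operator at `x` contributes.
    · have h1 : ∀ i, ‖a (.inl i) x‖ ^ 2 = 0 := by intro i; simp [a, h0]
      have h2 : ∀ x₀, ‖a (.inr x₀) x‖ ^ 2 = if x = x₀ then 1 else 0 := by
        intro x₀
        by_cases h : x = x₀
        · subst h; simp [a, h0]
        · simp [a, h]
      simp [h1, h2]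
    · have h2 : ∀ x₀, ‖a (.inr x₀) x‖ ^ 2 = 0 := by intro x₀; simp [a, h0]
      have h1 : ∀ e, ∑ j, ‖a (.inl (e, j)) x‖ ^ 2 =
          t e * padZeros N r (e (Fin.castLE hin x)) / ‖ψ x‖ ^ 2 := by
        intro e
        by_cases h : (e (Fin.castLE hin x)).val < d_out
        · simp only [padZeros, dif_pos h, hr_apply, a, Sum.elim_inl, Finset.mul_sum,
            Finset.sum_div]
          refine Finset.sum_congr rfl fun j _ => ?_
          rw [norm_div, norm_mul, Complex.norm_real, Real.norm_eq_abs, div_pow, mul_pow, sq_abs,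
            Real.sq_sqrt (mul_nonneg (ht0 e) (hp j)), hs, mul_assoc]
        · simp [padZeros, a, h]
      have hq : padZeros N (cohDist ψ) (Fin.castLE hin x) = ‖ψ x‖ ^ 2 := by
        simp [padZeros, cohDist]
      rw [Fintype.sum_prod_type]
      simp_rw [h1, h2, ← Finset.sum_div, ← ht, hq]
      have : ‖ψ x‖ ≠ 0 := norm_ne_zero_iff.2 h0
      simp [this]
  · rw [krausMap_pureState, Fintype.sum_sum_type]
    simp only [hact', Matrix.zero_vecMulVec, Finset.sum_const_zero, add_zero]
    ext b b'
    rw [heraldedState_apply, Matrix.sum_apply, Fintype.sum_prod_type]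
    simp only [Matrix.vecMulVec_apply, Pi.star_apply, hact]
    have h1 : ∀ e, ∑ j, (if j = b.1 then (√(t e * p j) : ℂ) * φ j b.2 else 0) *
        star (if j = b'.1 then (√(t e * p j) : ℂ) * φ j b'.2 else 0) =
        (t e : ℂ) * if b.1 = b'.1 then (p b.1 : ℂ) * (φ b.1 b.2 * star (φ b.1 b'.2)) else 0 := by
      intro e
      rw [Finset.sum_eq_single b.1]
      · by_cases h : b.1 = b'.1
        · have hsq : (√(t e * p b.1) : ℂ) * √(t e * p b.1) = t e * p b.1 := by
            rw [← Complex.ofReal_mul, Real.mul_self_sqrt (mul_nonneg (ht0 e) (hp _)),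
              Complex.ofReal_mul]
          simp only [if_true, if_pos h, star_mul, RCLike.star_def, Complex.conj_ofReal]
          linear_combination (φ b.1 b.2 * (starRingEnd ℂ) (φ b.1 b'.2)) * hsq
        · simp [h]
      · intro j _ hj; simp [hj]
      · simp
    simp_rw [h1, ← Finset.sum_mul, ← Complex.ofReal_sum, ht1, Complex.ofReal_one, one_mul]

theorem mainTheorem6 {d_in d_out m : ℕ}
    (ψ : EuclideanSpace ℂ (Fin d_in)) (hψ : ‖ψ‖ = 1)
    (p : Fin m → ℝ) (hp : ∀ j, 0 ≤ p j) (hp_sum : ∑ j, p j = 1)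
    (φ : Fin m → EuclideanSpace ℂ (Fin d_out)) (hφ : ∀ j, ‖φ j‖ = 1) :
    (∃ E : Matrix (Fin d_in) (Fin d_in) ℂ →CP
          Matrix (Fin m × Fin d_out) (Fin m × Fin d_out) ℂ,
        IsDIO E ∧ E (pureState ψ) = heraldedState p φ) ↔
      Majorized (cohDist ψ) (∑ j, p j • decreasing (cohDist (φ j))) :=
  ⟨fun ⟨E, hE, hEψ⟩ => majorized_of_isDIO ψ hψ p hp hp_sum φ hφ E hE hEψ,
    exists_isDIO_of_majorized ψ p hp hp_sum φ hφ⟩
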